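/- Let $\Pi=\{s\in\mathbb{C}:\operatorname{Re}s>0\}$, and for $G\subset\mathbb{C}$ let $\widetilde G$ be the convex hull of $G$. For a domain (nonempty connected open set) $G\subset\mathbb{C}$ with $\widetilde G\neq\mathbb{C}$, the isometric Bohr abscissa $b(G)\in[0,\infty]$ is the infimum of those real $\sigma\ge 0$ such that $$\sum_{n=2}^{\infty}\frac{|a_n|}{n^{\sigma}}<\operatorname{dist}(a_1,\partial\widetilde G)$$ for every bounded holomorphic function $f:\Pi\to G$ of the form $f(s)=\sum_{n=1}^{\infty}a_n n^{-s}$, the series converging (not necessarily absolutely) at every $s\in\Pi$. The abscissa $b_a(G)\in[0,\infty]$ is defined in the same manner, but with all functions $f:\Pi\to G$ of the form $f(s)=\sum_{n=1}^{\infty}a_n n^{-s}$ with the series converging absolutely at every $s\in\Pi$ (such $f$ need not be bounded). (An infimum over the empty set is $\infty$.) **Theorem 3.1.** If $G$ is a bounded convex domain in $\mathbb{C}$, then $b(G)\le 1.7267$. If $G$ is any domain in $\mathbb{C}$ with $\widetilde G\neq\mathbb{C}$, then $b_a(G)\le 1.7267$. -/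

import Mathlib

open Filter Topology

/-- The open right half-plane `Π = {s : Re s > 0}`. -/
def rightHalfPlane : Set ℂ := {s : ℂ | 0 < s.re}

/-- `f ∈ H^∞(Π)`: `f` is holomorphic and bounded in the right half-plane. -/
def MemHInfty (f : ℂ → ℂ) : Prop :=
  DifferentiableOn ℂ f rightHalfPlane ∧ ∃ C : ℝ, ∀ s ∈ rightHalfPlane, ‖f s‖ ≤ C

/-- `f(s) = ∑_{n ≥ 1} a_n n^{-s}` in `Π`, the partial sums (in the natural order) converging at
every point of `Π`; the convergence need not be absolute. The value `a 0` plays no role. -/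
def IsDirichletSeries (a : ℕ → ℂ) (f : ℂ → ℂ) : Prop :=
  ∀ s ∈ rightHalfPlane,
    Tendsto (fun N : ℕ => ∑ n ∈ Finset.Icc 1 N, a n / (n : ℂ) ^ s) atTop (𝓝 (f s))

/-- The Dirichlet series with coefficients `a` converges absolutely at every point of `Π`. -/
def AbsConvDirichlet (a : ℕ → ℂ) : Prop :=
  ∀ s ∈ rightHalfPlane, Summable (fun n : ℕ => ‖a (n + 1) / ((n + 1 : ℕ) : ℂ) ^ s‖)

/-- `∑_{n ≥ 2} |a_n| / n^σ` converges and is smaller than the distance from `a_1` to the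
boundary of the convex hull of `G`. -/
def BohrInequality (G : Set ℂ) (a : ℕ → ℂ) (σ : ℝ) : Prop :=
  Summable (fun n : ℕ => ‖a (n + 2)‖ / ((n + 2 : ℕ) : ℝ) ^ σ) ∧
    ∑' n : ℕ, ‖a (n + 2)‖ / ((n + 2 : ℕ) : ℝ) ^ σ <
      Metric.infDist (a 1) (frontier (convexHull ℝ G))

/-- The isometric Bohr abscissa `b(G)`, for bounded holomorphic functions on `Π` with values in
`G` which are sums of convergent Dirichlet series. The infimum is taken in the extended reals,
so that it is `⊤` if no `σ` is admissible. -/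
noncomputable def bohrAbscissa (G : Set ℂ) : EReal :=
  sInf ((fun σ : ℝ => (σ : EReal)) '' {σ : ℝ | 0 ≤ σ ∧
    ∀ (f : ℂ → ℂ) (a : ℕ → ℂ), MemHInfty f → IsDirichletSeries a f →
      Set.MapsTo f rightHalfPlane G → BohrInequality G a σ})

/-- The isometric Bohr abscissa `b_a(G)`, for functions on `Π` with values in `G` which are sums
of absolutely convergent Dirichlet series. The functions need not be bounded; replacing `f` by
`f(· + ε)`, `ε → 0`, shows that asking for boundedness as well would give the same infimum. -/
noncomputable def bohrAbscissaAbs (G : Set ℂ) : EReal :=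
  sInf ((fun σ : ℝ => (σ : EReal)) '' {σ : ℝ | 0 ≤ σ ∧
    ∀ (f : ℂ → ℂ) (a : ℕ → ℂ), IsDirichletSeries a f → AbsConvDirichlet a →
      Set.MapsTo f rightHalfPlane G → BohrInequality G a σ})

/-! Let `w` be a boundary point of the convex hull nearest to `a 1`, at distance `d`, and let `u` be
the unit normal of a supporting half-plane at `w`. Then `u * (w - f)` has positive real part on `Π`.
On the line `Re s = 0.0067` its Dirichlet coefficients `b n` satisfy `‖b n‖ = ‖a n‖ / n ^ 0.0067`
for `n ≥ 2` and `Re b 1 ≤ d`. As `1.7267 = 0.0067 + 1.72`, it is enough to bound `∑_{n ≥ 2} ‖b n‖ /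
n ^ 1.72` by `0.99 * Re b 1`.

Following Bohr, sort the `n` by `k = Ω n`, as if the primes were independent variables. Positivity
of the real part gives two bounds: each `k`-homogeneous part has `ℓ²` norm at most `2 Re b 1`
(`IsToeplitzPos.sum_norm_sq_le`), and for `k = 1` even the `ℓ¹` norm is at most `2 Re b 1`
(`IsToeplitzPos.sum_prime_norm_le`). Boundary values on a polytorus are avoided: means along a
vertical line yield the positive kernel `b (m / l)`, and testing it on characters restricted to the
divisors of `N` plays the role of a Fejér kernel.

For `k ≥ 2`, Cauchy-Schwarz and `∑_{Ω n = k} (2 ^ k / n) ^ 3 ≤ 2` bound the `k`-th part by `2√2 * 2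
^ (-1.72 k) * Re b 1`. Adding `2 * 2 ^ (-1.72) * Re b 1` for the primes and summing the geometric
series leaves a constant below `0.99`. -/

/-! ### Mean values of trigonometric sums and series -/

/-- The mean value `lim_{T → ∞} T⁻¹ ∫_0^T φ` exists and equals `L`. -/
def HasMean (φ : ℝ → ℂ) (L : ℂ) : Prop :=
  Tendsto (fun T : ℝ => (T : ℂ)⁻¹ * ∫ t in (0 : ℝ)..T, φ t) atTop (𝓝 L)

theorem norm_exp_I_mul_real (x : ℝ) : ‖Complex.exp (Complex.I * x)‖ = 1 := by
  rw [mul_comm, Complex.norm_exp_ofReal_mul_I]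

theorem HasMean.const_mul {φ : ℝ → ℂ} {L : ℂ} (h : HasMean φ L) (c : ℂ) :
    HasMean (fun t => c * φ t) (c * L) := by
  have := Tendsto.const_mul c h
  refine this.congr fun T => ?_
  rw [intervalIntegral.integral_const_mul]
  ring

theorem HasMean.finset_sum {ι : Type*} (s : Finset ι) {φ : ι → ℝ → ℂ} {L : ι → ℂ}
    (hc : ∀ i ∈ s, Continuous (φ i)) (h : ∀ i ∈ s, HasMean (φ i) (L i)) :
    HasMean (fun t => ∑ i ∈ s, φ i t) (∑ i ∈ s, L i) := by
  have := tendsto_finsetSum s h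
  refine this.congr fun T => ?_
  rw [intervalIntegral.integral_finsetSum fun i hi => (hc i hi).intervalIntegrable _ _,
    Finset.mul_sum]

theorem HasMean.re_nonneg {φ : ℝ → ℂ} {L : ℂ} (hc : Continuous φ) (h : HasMean φ L)
    (h0 : ∀ t, 0 ≤ (φ t).re) : 0 ≤ L.re := by
  have h1 := (Complex.continuous_re.tendsto _).comp h
  refine ge_of_tendsto h1 ?_
  filter_upwards [eventually_gt_atTop (0 : ℝ)] with T hT
  have h2 : (∫ t in (0 : ℝ)..T, φ t).re = ∫ t in (0 : ℝ)..T, (φ t).re := by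
    have := Complex.reCLM.intervalIntegral_comp_comm (hc.intervalIntegrable (μ := MeasureTheory.volume) 0 T)
    simpa using this.symm
  simp only [Function.comp]
  rw [← Complex.ofReal_inv, Complex.re_ofReal_mul, h2]
  exact mul_nonneg (inv_nonneg.2 hT.le)
    (intervalIntegral.integral_nonneg hT.le fun t _ => h0 t)

theorem HasMean.re_le {φ : ℝ → ℂ} {L : ℂ} {C : ℝ} (hc : Continuous φ) (h : HasMean φ L)
    (h0 : ∀ t, (φ t).re ≤ C) : L.re ≤ C := by
  have h1 := (Complex.continuous_re.tendsto _).comp h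
  refine le_of_tendsto h1 ?_
  filter_upwards [eventually_gt_atTop (0 : ℝ)] with T hT
  have h2 : (∫ t in (0 : ℝ)..T, φ t).re = ∫ t in (0 : ℝ)..T, (φ t).re := by
    have := Complex.reCLM.intervalIntegral_comp_comm (hc.intervalIntegrable (μ := MeasureTheory.volume) 0 T)
    simpa using this.symm
  simp only [Function.comp]
  rw [← Complex.ofReal_inv, Complex.re_ofReal_mul, h2]
  have h3 : ∫ t in (0 : ℝ)..T, (φ t).re ≤ ∫ t in (0 : ℝ)..T, C :=
    intervalIntegral.integral_mono_on hT.le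
      ((Complex.continuous_re.comp hc).intervalIntegrable _ _) (by simp) fun t _ => h0 t
  rw [intervalIntegral.integral_const, sub_zero, smul_eq_mul] at h3
  rw [inv_mul_le_iff₀ hT]
  exact h3

theorem norm_mean_exp_le (x T : ℝ) :
    ‖(T : ℂ)⁻¹ * ∫ t in (0 : ℝ)..T, Complex.exp (Complex.I * (x * t : ℝ))‖ ≤ 1 := by
  have h := intervalIntegral.norm_integral_le_of_norm_le_const (a := 0) (b := T) (C := 1)
    (f := fun t : ℝ => Complex.exp (Complex.I * (x * t : ℝ)))
    fun t _ => (norm_exp_I_mul_real _).le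
  rw [norm_mul, norm_inv, Complex.norm_real, Real.norm_eq_abs]
  rw [sub_zero, one_mul] at h
  by_cases hT : T = 0
  · simp [hT]
  · rw [inv_mul_le_iff₀ (abs_pos.2 hT), mul_one]
    exact h

theorem hasMean_exp (x : ℝ) :
    HasMean (fun t => Complex.exp (Complex.I * (x * t : ℝ))) (if x = 0 then 1 else 0) := by
  split_ifs with hx
  · subst hx
    refine tendsto_const_nhds.congr' ?_
    filter_upwards [eventually_gt_atTop (0 : ℝ)] with T hT
    have : (T : ℂ) ≠ 0 := by exact_mod_cast hT.ne'
    simp [this]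
  · have hx' : Complex.I * (x : ℂ) ≠ 0 := by simp [hx]
    have key : ∀ T : ℝ, (∫ t in (0 : ℝ)..T, Complex.exp (Complex.I * (x * t : ℝ))) =
        (Complex.exp (Complex.I * (x * T : ℝ)) - 1) / (Complex.I * x) := by
      intro T
      have := integral_exp_mul_complex (a := 0) (b := T) hx'
      simp only [Complex.ofReal_zero, mul_zero, Complex.exp_zero] at this
      rw [Complex.ofReal_mul, ← mul_assoc, ← this]
      refine intervalIntegral.integral_congr fun t _ => ?_
      simp only [Complex.ofReal_mul, mul_assoc]
    refine squeeze_zero_norm' (a := fun T : ℝ => T⁻¹ * (2 / |x|)) ?_ ?_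
    · filter_upwards [eventually_gt_atTop (0 : ℝ)] with T hT
      rw [key, norm_mul, norm_inv, Complex.norm_real, Real.norm_of_nonneg hT.le, norm_div,
        norm_mul, Complex.norm_I, one_mul, Complex.norm_real, Real.norm_eq_abs]
      gcongr
      refine (norm_sub_le _ _).trans ?_
      rw [norm_exp_I_mul_real, norm_one]
      norm_num
    · simpa using tendsto_inv_atTop_zero.mul_const (2 / |x|)

theorem continuous_exp_I_mul (x : ℝ) :
    Continuous fun t : ℝ => Complex.exp (Complex.I * (x * t : ℝ)) := by
  fun_prop

theorem hasMean_trigSum {ι : Type*} (s : Finset ι) (c : ι → ℂ) (x : ι → ℝ) :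
    HasMean (fun t => ∑ i ∈ s, c i * Complex.exp (Complex.I * (x i * t : ℝ)))
      (∑ i ∈ s, if x i = 0 then c i else 0) := by
  have := HasMean.finset_sum s (φ := fun i t => c i * Complex.exp (Complex.I * (x i * t : ℝ)))
    (fun i _ => (continuous_exp_I_mul (x i)).const_smul (c i))
    (fun i _ => (hasMean_exp (x i)).const_mul (c i))
  simpa using this

theorem continuous_trigSeries {c : ℕ → ℂ} (hc : Summable fun n => ‖c n‖) (x : ℕ → ℝ) :
    Continuous fun t : ℝ => ∑' n, c n * Complex.exp (Complex.I * (x n * t : ℝ)) := by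
  refine continuous_tsum (fun n => (continuous_exp_I_mul (x n)).const_smul (c n)) hc ?_
  intro n t
  rw [norm_mul, norm_exp_I_mul_real, mul_one]

/-- Dominated convergence is used twice with the majorant `‖c n‖`: to integrate termwise over `[0,
T]`, and to let `T → ∞` under the sum. -/
theorem hasMean_trigSeries {c : ℕ → ℂ} (hc : Summable fun n => ‖c n‖) (x : ℕ → ℝ) :
    HasMean (fun t => ∑' n, c n * Complex.exp (Complex.I * (x n * t : ℝ)))
      (∑' n, if x n = 0 then c n else 0) := by
  have h1 : Tendsto (fun T : ℝ => ∑' n, c n * ((T : ℂ)⁻¹ *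
      ∫ t in (0 : ℝ)..T, Complex.exp (Complex.I * (x n * t : ℝ)))) atTop
      (𝓝 (∑' n, c n * if x n = 0 then 1 else 0)) := by
    refine tendsto_tsum_of_dominated_convergence (bound := fun n => ‖c n‖) hc
      (fun n => Tendsto.const_mul (c n) (hasMean_exp (x n))) ?_
    filter_upwards with T n
    rw [norm_mul]
    exact mul_le_of_le_one_right (norm_nonneg _) (norm_mean_exp_le _ _)
  simp only [mul_ite, mul_one, mul_zero] at h1
  refine h1.congr fun T => ?_
  have h2 : HasSum (fun n => ∫ t in (0 : ℝ)..T, c n * Complex.exp (Complex.I * (x n * t : ℝ)))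
      (∫ t in (0 : ℝ)..T, ∑' n, c n * Complex.exp (Complex.I * (x n * t : ℝ))) := by
    refine intervalIntegral.hasSum_integral_of_dominated_convergence (fun n _ => ‖c n‖)
      (fun n => ((continuous_exp_I_mul (x n)).const_smul (c n)).aestronglyMeasurable) ?_ ?_ ?_ ?_
    · intro n
      filter_upwards with t _
      rw [norm_mul, norm_exp_I_mul_real, mul_one]
    · filter_upwards with t _ using hc
    · simp
    · filter_upwards with t _
      refine Summable.hasSum (Summable.of_norm ?_)
      simpa only [norm_mul, norm_exp_I_mul_real, mul_one] using hc
  rw [← h2.tsum_eq, ← tsum_mul_left]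
  refine tsum_congr fun n => ?_
  rw [intervalIntegral.integral_const_mul]
  ring

/-! ### Dirichlet series on vertical lines -/

theorem ofReal_add_mul_I_mem_rightHalfPlane {σ : ℝ} (hσ : 0 < σ) (t : ℝ) :
    (σ + t * Complex.I : ℂ) ∈ rightHalfPlane := by
  simp [rightHalfPlane, hσ]

theorem sum_Icc_one_eq_sum_range (g : ℕ → ℂ) (N : ℕ) :
    ∑ n ∈ Finset.Icc 1 N, g n = ∑ n ∈ Finset.range N, g (n + 1) := by
  induction N with
  | zero => simp
  | succ N ih => rw [Finset.sum_Icc_succ_top (by omega), ih, Finset.sum_range_succ]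

theorem div_natCast_cpow_line (a : ℂ) (n : ℕ) (σ t : ℝ) :
    a / ((n + 1 : ℕ) : ℂ) ^ (σ + t * Complex.I : ℂ) =
      a / ((n + 1 : ℕ) : ℂ) ^ (σ : ℂ) *
        Complex.exp (Complex.I * (-Real.log (n + 1 : ℕ) * t : ℝ)) := by
  have h0 : ((n + 1 : ℕ) : ℂ) ≠ 0 := Nat.cast_ne_zero.2 n.succ_ne_zero
  rw [Complex.cpow_add _ _ h0, div_mul_eq_div_div, div_eq_mul_inv _ (_ ^ (t * Complex.I)),
    Complex.cpow_def_of_ne_zero h0 (t * Complex.I), ← Complex.exp_neg, ← Complex.natCast_log]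
  congr 2
  push_cast
  ring

/-- Continuity of `f` on the line `Re s = σ`, and the formula for the mean values of
`f` against the exponentials there. -/
def HasDirichletMeans (a : ℕ → ℂ) (f : ℂ → ℂ) (σ : ℝ) : Prop :=
  Continuous (fun t : ℝ => f (σ + t * Complex.I)) ∧
    ∀ x : ℝ, HasMean (fun t => f (σ + t * Complex.I) * Complex.exp (Complex.I * (x * t : ℝ)))
      (∑' n : ℕ, if Real.log (n + 1 : ℕ) = x then a (n + 1) / ((n + 1 : ℕ) : ℂ) ^ (σ : ℂ) else 0)

theorem IsDirichletSeries.eq_trigSeries {a : ℕ → ℂ} {f : ℂ → ℂ} (h : IsDirichletSeries a f)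
    {σ : ℝ} (hσ : 0 < σ) (hs : Summable fun n : ℕ => ‖a (n + 1) / ((n + 1 : ℕ) : ℂ) ^ (σ : ℂ)‖)
    (t : ℝ) :
    f (σ + t * Complex.I) = ∑' n : ℕ, a (n + 1) / ((n + 1 : ℕ) : ℂ) ^ (σ : ℂ) *
      Complex.exp (Complex.I * (-Real.log (n + 1 : ℕ) * t : ℝ)) := by
  have h1 := h _ (ofReal_add_mul_I_mem_rightHalfPlane hσ t)
  have h2 : Summable fun n : ℕ => a (n + 1) / ((n + 1 : ℕ) : ℂ) ^ (σ : ℂ) *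
      Complex.exp (Complex.I * (-Real.log (n + 1 : ℕ) * t : ℝ)) := by
    refine Summable.of_norm ?_
    simpa only [norm_mul, norm_exp_I_mul_real, mul_one] using hs
  refine tendsto_nhds_unique h1 (h2.hasSum.tendsto_sum_nat.congr fun N => ?_)
  rw [sum_Icc_one_eq_sum_range]
  exact Finset.sum_congr rfl fun n _ => (div_natCast_cpow_line _ _ _ _).symm

theorem IsDirichletSeries.hasDirichletMeans_of_summable {a : ℕ → ℂ} {f : ℂ → ℂ}
    (h : IsDirichletSeries a f) {σ : ℝ} (hσ : 0 < σ)
    (hs : Summable fun n : ℕ => ‖a (n + 1) / ((n + 1 : ℕ) : ℂ) ^ (σ : ℂ)‖) :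
    HasDirichletMeans a f σ := by
  constructor
  · simp_rw [h.eq_trigSeries hσ hs]
    exact continuous_trigSeries hs _
  · intro x
    have h1 := hasMean_trigSeries hs fun n => x - Real.log (n + 1 : ℕ)
    simp only [sub_eq_zero] at h1
    simp only [eq_comm (b := x)]
    convert h1 using 2 with t
    rw [h.eq_trigSeries hσ hs, ← tsum_mul_right]
    refine tsum_congr fun n => ?_
    rw [mul_assoc, ← Complex.exp_add]
    congr 2
    push_cast
    ring

theorem AbsConvDirichlet.hasDirichletMeans {a : ℕ → ℂ} {f : ℂ → ℂ}
    (ha : AbsConvDirichlet a) (h : IsDirichletSeries a f) {σ : ℝ} (hσ : 0 < σ) :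
    HasDirichletMeans a f σ :=
  h.hasDirichletMeans_of_summable hσ (ha σ (by simpa [rightHalfPlane] using hσ))

theorem norm_natCast_succ_cpow (n : ℕ) (σ : ℝ) :
    ‖((n + 1 : ℕ) : ℂ) ^ (σ : ℂ)‖ = ((n + 1 : ℕ) : ℝ) ^ σ := by
  rw [Complex.norm_natCast_cpow_of_pos n.succ_pos, Complex.ofReal_re]

/-- Convergence at `s = 1/2` forces `a n = O(n ^ (1/2))`, and `∑ n ^ (-3/2)` converges. -/
theorem IsDirichletSeries.summable_two {a : ℕ → ℂ} {f : ℂ → ℂ} (h : IsDirichletSeries a f) :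
    Summable fun n : ℕ => ‖a (n + 1) / ((n + 1 : ℕ) : ℂ) ^ ((2 : ℝ) : ℂ)‖ := by
  have h1 := h ((1 / 2 : ℝ) : ℂ) (by simp [rightHalfPlane])
  simp only [sum_Icc_one_eq_sum_range] at h1
  have h2 : Tendsto (fun n : ℕ => a (n + 1) / ((n + 1 : ℕ) : ℂ) ^ ((1 / 2 : ℝ) : ℂ)) atTop
      (𝓝 0) := by
    have := (h1.comp (tendsto_add_atTop_nat 1)).sub h1
    simpa [Function.comp_def, Finset.sum_range_succ] using this
  obtain ⟨C, hC⟩ := h2.norm.bddAbove_range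
  have h3 : Summable fun n : ℕ => C * (1 / ((n + 1 : ℕ) : ℝ) ^ (3 / 2 : ℝ)) :=
    ((summable_nat_add_iff 1).2
      (Real.summable_one_div_nat_rpow.2 (by norm_num : (1 : ℝ) < 3 / 2))).mul_left C
  refine Summable.of_nonneg_of_le (fun _ => norm_nonneg _) (fun n => ?_) h3
  have h4 : ‖a (n + 1) / ((n + 1 : ℕ) : ℂ) ^ ((1 / 2 : ℝ) : ℂ)‖ ≤ C := hC ⟨n, rfl⟩
  have hpos : (0 : ℝ) < ((n + 1 : ℕ) : ℝ) := Nat.cast_pos.2 n.succ_pos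
  rw [norm_div, norm_natCast_succ_cpow] at h4 ⊢
  have h5 : ((n + 1 : ℕ) : ℝ) ^ (2 : ℝ) =
      ((n + 1 : ℕ) : ℝ) ^ (1 / 2 : ℝ) * ((n + 1 : ℕ) : ℝ) ^ (3 / 2 : ℝ) := by
    rw [← Real.rpow_add hpos]
    norm_num
  rw [h5, div_mul_eq_div_div, div_eq_mul_one_div _ (_ ^ (3 / 2 : ℝ))]
  gcongr

/-- Mean values along vertical lines do not depend on the line, for bounded functions. -/
theorem HasMean.shift {g : ℂ → ℂ} (hg : DifferentiableOn ℂ g rightHalfPlane) {σ τ C : ℝ}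
    (hσ : 0 < σ) (hστ : σ ≤ τ) (hC : ∀ s : ℂ, σ ≤ s.re → s.re ≤ τ → ‖g s‖ ≤ C) {L : ℂ}
    (h : HasMean (fun t => g (τ + t * Complex.I)) L) :
    HasMean (fun t => g (σ + t * Complex.I)) L := by
  have hz : Tendsto (fun T : ℝ => (T : ℂ)⁻¹ * ((∫ t in (0 : ℝ)..T, g (σ + t * Complex.I)) -
      ∫ t in (0 : ℝ)..T, g (τ + t * Complex.I))) atTop (𝓝 0) := by
    refine squeeze_zero_norm' (a := fun T : ℝ => T⁻¹ * (C * |τ - σ| + C * |τ - σ|)) ?_ ?_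
    · filter_upwards [eventually_gt_atTop (0 : ℝ)] with T hT
      -- By Cauchy's theorem on `[σ, τ] × [0, T]`, the two vertical integrals differ by the
      -- horizontal ones, which stay bounded and vanish after division by `T`.
      have hrect := Complex.integral_boundary_rect_eq_zero_of_differentiableOn g (σ : ℂ)
        (τ + T * Complex.I) (hg.mono ?_)
      · have hb : ∀ y : ℝ, ‖∫ x in σ..τ, g (x + y * Complex.I)‖ ≤ C * |τ - σ| := by
          intro y
          refine intervalIntegral.norm_integral_le_of_norm_le_const fun x hx => ?_
          rw [Set.uIoc_of_le hστ] at hx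
          exact hC _ (by simpa using hx.1.le) (by simpa using hx.2)
        have h1 := hb 0
        have h2 := hb T
        simp only [Complex.ofReal_re, Complex.ofReal_im, Complex.add_re, Complex.mul_re,
          Complex.I_re, mul_zero, Complex.I_im, mul_one, sub_self, add_zero, Complex.add_im,
          Complex.mul_im, zero_add, smul_eq_mul] at hrect
        have h3 : Complex.I * ((∫ t in (0 : ℝ)..T, g (σ + t * Complex.I)) -
            ∫ t in (0 : ℝ)..T, g (τ + t * Complex.I)) =
            (∫ x in σ..τ, g (x + (0 : ℝ) * Complex.I)) - ∫ x in σ..τ, g (x + T * Complex.I) := by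
          linear_combination -hrect
        have h4 : ‖(∫ t in (0 : ℝ)..T, g (σ + t * Complex.I)) -
            ∫ t in (0 : ℝ)..T, g (τ + t * Complex.I)‖ ≤ C * |τ - σ| + C * |τ - σ| := by
          rw [← one_mul ‖_‖, ← Complex.norm_I, ← norm_mul, h3]
          exact (norm_sub_le _ _).trans (add_le_add h1 h2)
        rw [norm_mul, norm_inv, Complex.norm_real, Real.norm_of_nonneg hT.le]
        gcongr
      · intro s hs
        have := (Complex.mem_reProdIm.1 hs).1
        simp only [Complex.ofReal_re, Complex.add_re, Complex.mul_re, Complex.I_re, mul_zero,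
          Complex.ofReal_im, Complex.I_im, mul_one, sub_self, add_zero, Set.uIcc_of_le hστ] at this
        exact hσ.trans_le this.1
    · simpa using tendsto_inv_atTop_zero.mul_const (C * |τ - σ| + C * |τ - σ|)
  have := hz.add h
  rw [zero_add] at this
  refine this.congr fun T => ?_
  ring

/-- Absolute convergence may fail near the imaginary axis, but it holds on `Re s = 2`. The means
there are carried to `Re s = σ` by `HasMean.shift`. The function shifted is `f s * exp (x s)`, the
holomorphic form of `f` times the exponential of frequency `x`; the real factors `exp (x * 2)` and
`exp (x * σ)` account for the change in the power of `n`. -/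
theorem MemHInfty.hasDirichletMeans {a : ℕ → ℂ} {f : ℂ → ℂ}
    (hf : MemHInfty f) (h : IsDirichletSeries a f) {σ : ℝ} (hσ : 0 < σ) (hσ2 : σ ≤ 2) :
    HasDirichletMeans a f σ := by
  refine ⟨hf.1.continuousOn.comp_continuous (by fun_prop)
    (ofReal_add_mul_I_mem_rightHalfPlane hσ), fun x => ?_⟩
  obtain ⟨hd, C, hC⟩ := hf
  have h2 := (h.hasDirichletMeans_of_summable two_pos h.summable_two).2 x
  have hexp : ∀ (r t : ℝ), Complex.exp (x * (r + t * Complex.I)) =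
      Complex.exp (x * r) * Complex.exp (Complex.I * (x * t : ℝ)) := by
    intro r t
    rw [← Complex.exp_add]
    congr 1
    push_cast
    ring
  have h3 := HasMean.shift (g := fun s => f s * Complex.exp (x * s)) (σ := σ) (τ := 2)
    (C := C * Real.exp (|x| * 2)) (hd.mul (by fun_prop)) hσ hσ2 ?_
    (L := Complex.exp (x * (2 : ℝ)) * _) (by
      convert h2.const_mul (Complex.exp (x * (2 : ℝ))) using 2 with t
      rw [hexp]
      ring)
  · have h4 := h3.const_mul (Complex.exp (-(x * σ)))
    convert h4 using 2 with t
    · rw [hexp, Complex.exp_neg]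
      field_simp
    · rw [← mul_assoc, ← tsum_mul_left]
      refine tsum_congr fun n => ?_
      split_ifs with hx
      · have h0 : ((n + 1 : ℕ) : ℂ) ≠ 0 := Nat.cast_ne_zero.2 n.succ_ne_zero
        rw [Complex.cpow_def_of_ne_zero h0, Complex.cpow_def_of_ne_zero h0, Complex.exp_neg,
          ← Complex.natCast_log, hx]
        field_simp
      · rw [mul_zero]
  · intro s h1 h2
    have hs : 0 < s.re := hσ.trans_le h1
    rw [norm_mul, Complex.norm_exp, Complex.re_ofReal_mul]
    have h5 : x * s.re ≤ |x| * 2 :=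
      (mul_le_mul_of_nonneg_right (le_abs_self x) hs.le).trans
        (mul_le_mul_of_nonneg_left h2 (abs_nonneg x))
    exact mul_le_mul (hC s hs) (Real.exp_le_exp.2 h5) (Real.exp_pos _).le
      ((norm_nonneg _).trans (hC s hs))

/-! ### Positivity of the kernel `b (m / l)` -/

open ComplexConjugate in
/-- The Toeplitz-type kernel `(m, l) ↦ b (m / l)` (zero unless `l ∣ m`) has positive semidefinite
real part. -/
def IsToeplitzPos (b : ℕ → ℂ) : Prop :=
  ∀ (S : Finset ℕ), (∀ m ∈ S, m ≠ 0) → ∀ c : ℕ → ℂ,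
    0 ≤ (∑ m ∈ S, ∑ l ∈ S, if l ∣ m then c m * conj (c l) * b (m / l) else 0).re

/-- The frequency `log m - log l` is the logarithm of an integer exactly when `l ∣ m`, so at most
one term survives. -/
theorem tsum_log_eq_log_sub_log (b : ℕ → ℂ) {m l : ℕ} (hm : m ≠ 0) (hl : l ≠ 0) :
    (∑' n : ℕ, if Real.log (n + 1 : ℕ) = Real.log m - Real.log l then b (n + 1) else 0) =
      if l ∣ m then b (m / l) else 0 := by
  have hlr : (0 : ℝ) < l := Nat.cast_pos.2 (Nat.pos_of_ne_zero hl)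
  have hmr : (0 : ℝ) < m := Nat.cast_pos.2 (Nat.pos_of_ne_zero hm)
  have key : ∀ n : ℕ, Real.log (n + 1 : ℕ) = Real.log m - Real.log l ↔ (n + 1) * l = m := by
    intro n
    have hn : (0 : ℝ) < (n + 1 : ℕ) := Nat.cast_pos.2 n.succ_pos
    rw [eq_sub_iff_add_eq, ← Real.log_mul hn.ne' hlr.ne',
      Real.log_injOn_pos.eq_iff (mul_pos hn hlr) hmr, ← Nat.cast_mul, Nat.cast_inj]
  simp only [key]
  split_ifs with h
  · obtain ⟨q, rfl⟩ := h
    have hq : q ≠ 0 := right_ne_zero_of_mul hm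
    rw [tsum_eq_single (q - 1), Nat.sub_add_cancel (Nat.pos_of_ne_zero hq), if_pos (mul_comm _ _),
      Nat.mul_div_cancel_left _ (Nat.pos_of_ne_zero hl)]
    intro n hn
    refine if_neg fun h => hn ?_
    rw [mul_comm] at h
    have := Nat.eq_of_mul_eq_mul_left (Nat.pos_of_ne_zero hl) h
    omega
  · refine (tsum_congr fun n => if_neg fun hn => h ?_).trans tsum_zero
    exact Dvd.intro_left _ hn

open ComplexConjugate in
theorem HasDirichletMeans.isToeplitzPos {a : ℕ → ℂ} {f : ℂ → ℂ} {σ : ℝ}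
    (h : HasDirichletMeans a f σ) (hpos : ∀ t : ℝ, 0 ≤ (f (σ + t * Complex.I)).re) :
    IsToeplitzPos fun n => a n / (n : ℂ) ^ (σ : ℂ) := by
  intro S hS c
  let e : ℕ → ℝ → ℂ := fun m t => Complex.exp (Complex.I * (Real.log m * t : ℝ))
  let φ : ℕ → ℕ → ℝ → ℂ := fun m l t => c m * conj (c l) * (f (σ + t * Complex.I) *
    Complex.exp (Complex.I * ((Real.log m - Real.log l) * t : ℝ)))
  have hcont : ∀ m l, Continuous (φ m l) := fun m l =>
    (h.1.mul (continuous_exp_I_mul _)).const_smul (c m * conj (c l))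
  have hmean : HasMean (fun t => ∑ m ∈ S, ∑ l ∈ S, φ m l t) (∑ m ∈ S, ∑ l ∈ S,
      if l ∣ m then c m * conj (c l) * (a (m / l) / ((m / l : ℕ) : ℂ) ^ (σ : ℂ)) else 0) := by
    refine HasMean.finset_sum S (fun m _ => continuous_finsetSum _ fun l _ => hcont m l)
      fun m hm => HasMean.finset_sum S (fun l _ => hcont m l) fun l hl => ?_
    have h1 := (h.2 (Real.log m - Real.log l)).const_mul (c m * conj (c l))
    rw [tsum_log_eq_log_sub_log (fun n => a n / (n : ℂ) ^ (σ : ℂ)) (hS m hm) (hS l hl), mul_ite,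
      mul_zero] at h1
    exact h1
  refine hmean.re_nonneg
    (continuous_finsetSum _ fun m _ => continuous_finsetSum _ fun l _ => hcont m l) fun t => ?_
  -- The quadratic form is the mean of `f` times the squared modulus of the Dirichlet polynomial `∑
  -- c m * m ^ (i t)`.
  have hsq : ∑ m ∈ S, ∑ l ∈ S, φ m l t =
      (Complex.normSq (∑ m ∈ S, c m * e m t) : ℝ) * f (σ + t * Complex.I) := by
    rw [Complex.normSq_eq_conj_mul_self, map_sum, mul_comm (∑ m ∈ S, _), Finset.sum_mul_sum,
      Finset.sum_mul]
    refine Finset.sum_congr rfl fun m _ => ?_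
    rw [Finset.sum_mul]
    refine Finset.sum_congr rfl fun l _ => ?_
    have hconj : conj (e l t) = Complex.exp (-(Complex.I * (Real.log l * t : ℝ))) := by
      rw [← Complex.exp_conj, map_mul, Complex.conj_I, Complex.conj_ofReal, neg_mul]
    have hexp : Complex.exp (Complex.I * ((Real.log m - Real.log l) * t : ℝ)) =
        e m t * conj (e l t) := by
      rw [hconj, ← Complex.exp_add]
      congr 1
      push_cast
      ring
    simp only [φ, hexp, map_mul]
    ring
  rw [hsq, Complex.re_ofReal_mul]
  exact mul_nonneg (Complex.normSq_nonneg _) (hpos t)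

/-! ### Testing on characters; homogeneous parts -/

/-- The number of divisors of `N` which are multiples of `n`. -/
def multipleDivisorsCard (N n : ℕ) : ℕ := (N.divisors.filter (n ∣ ·)).card

/-- A unimodular function on the positive integers which is completely multiplicative. -/
structure IsUnimodularChar (χ : ℕ → ℂ) : Prop where
  norm_eq : ∀ n, n ≠ 0 → ‖χ n‖ = 1
  mul : ∀ m n, m ≠ 0 → n ≠ 0 → χ (m * n) = χ m * χ n

theorem IsUnimodularChar.one {χ : ℕ → ℂ} (h : IsUnimodularChar χ) : χ 1 = 1 := by
  have h1 := h.mul 1 1 one_ne_zero one_ne_zero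
  have h2 : χ 1 ≠ 0 := fun h0 => by simpa [h0] using h.norm_eq 1 one_ne_zero
  rw [mul_one] at h1
  exact (mul_eq_left₀ h2).1 h1.symm

-- Take `c = χ` on the divisors of `N`. Since `χ m * conj (χ l) = χ (m / l)`, the form depends only
-- on quotients, and `n` occurs as a quotient once for each divisor of `N` that is a multiple of
-- `n`.
open ComplexConjugate in
theorem IsToeplitzPos.re_sum_divisors_nonneg {b : ℕ → ℂ} (hb : IsToeplitzPos b) {χ : ℕ → ℂ}
    (hχ : IsUnimodularChar χ) (N : ℕ) :
    0 ≤ (∑ n ∈ N.divisors, (multipleDivisorsCard N n : ℂ) * b n * χ n).re := by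
  have h := hb N.divisors (fun m hm => (Nat.pos_of_mem_divisors hm).ne') χ
  convert h using 2
  have h1 : ∀ m ∈ N.divisors, (∑ l ∈ N.divisors,
      if l ∣ m then χ m * conj (χ l) * b (m / l) else 0) =
      ∑ n ∈ N.divisors, if n ∣ m then b n * χ n else 0 := by
    intro m hm
    have hm0 : m ≠ 0 := (Nat.pos_of_mem_divisors hm).ne'
    have hfil : N.divisors.filter (· ∣ m) = m.divisors := by
      ext l
      simp only [Finset.mem_filter, Nat.mem_divisors] at hm ⊢
      exact ⟨fun h => ⟨h.2, hm0⟩, fun h => ⟨⟨h.1.trans hm.1, hm.2⟩, h.1⟩⟩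
    rw [← Finset.sum_filter, ← Finset.sum_filter, hfil,
      ← Nat.sum_div_divisors m fun n => b n * χ n]
    refine Finset.sum_congr rfl fun l hl => ?_
    obtain ⟨q, rfl⟩ := Nat.dvd_of_mem_divisors hl
    have hl0 : l ≠ 0 := left_ne_zero_of_mul hm0
    have hq0 : q ≠ 0 := right_ne_zero_of_mul hm0
    rw [Nat.mul_div_cancel_left _ (Nat.pos_of_ne_zero hl0), hχ.mul l q hl0 hq0]
    have : χ l * conj (χ l) = 1 := by
      rw [Complex.mul_conj, Complex.normSq_eq_norm_sq, hχ.norm_eq l hl0]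
      norm_num
    linear_combination (χ q * b q) * this
  rw [Finset.sum_congr rfl h1, Finset.sum_comm]
  refine Finset.sum_congr rfl fun n _ => ?_
  rw [← Finset.sum_filter, Finset.sum_const, nsmul_eq_mul, mul_assoc]
  rfl

/-- Coefficient bound for trigonometric polynomials, with frequencies in `ℕ`, of nonnegative real
part. -/
theorem norm_sum_filter_le_of_re_nonneg {ι : Type*} (S : Finset ι) (β : ι → ℂ) (d : ι → ℕ)
    (h : ∀ t : ℝ, 0 ≤ (∑ n ∈ S, β n * Complex.exp (Complex.I * (d n * t : ℝ))).re)
    {k : ℕ} (hk : k ≠ 0) :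
    ‖∑ n ∈ S with d n = k, β n‖ ≤ 2 * (∑ n ∈ S with d n = 0, β n).re := by
  set g := ∑ n ∈ S with d n = k, β n with hg
  obtain ⟨v, hv, hvg⟩ : ∃ v : ℂ, ‖v‖ = 1 ∧ v * g = -‖g‖ := by
    obtain ⟨u, hu, hug⟩ := RCLike.exists_norm_eq_mul_self g
    exact ⟨-u, by rw [norm_neg, hu], by rw [neg_mul, ← hug]; rfl⟩
  have h0 := hasMean_trigSum S β fun n => (d n : ℝ)
  have h1 := hasMean_trigSum S β fun n => (d n : ℝ) - k
  have h2 := hasMean_trigSum S β fun n => (d n : ℝ) + k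
  have hv' : v * (starRingEnd ℂ) v = 1 := by
    rw [Complex.mul_conj, Complex.normSq_eq_norm_sq, hv]
    norm_num
  have hc : ∀ x : ι → ℝ, Continuous fun t : ℝ =>
      ∑ n ∈ S, β n * Complex.exp (Complex.I * (x n * t : ℝ)) := fun x => by fun_prop
  -- Multiply by the nonnegative kernel `2 + 2 Re (v * exp (-i k t))`, split by frequency. Its mean
  -- against the polynomial is twice the constant coefficient plus `v * g = -‖g‖`; the conjugate
  -- term contributes nothing because there are no negative frequencies.
  have hs := HasMean.finset_sum (Finset.univ : Finset (Fin 3))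
    (φ := ![fun t => 2 * ∑ n ∈ S, β n * Complex.exp (Complex.I * ((d n : ℝ) * t : ℝ)),
      fun t => v * ∑ n ∈ S, β n * Complex.exp (Complex.I * (((d n : ℝ) - k) * t : ℝ)),
      fun t => (starRingEnd ℂ) v *
        ∑ n ∈ S, β n * Complex.exp (Complex.I * (((d n : ℝ) + k) * t : ℝ))])
    (L := ![_, _, _])
    (by
      intro i _
      fin_cases i
      · exact (hc _).const_smul (2 : ℂ)
      · exact (hc _).const_smul v
      · exact (hc _).const_smul ((starRingEnd ℂ) v))
    (by
      intro i _
      fin_cases i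
      · exact h0.const_mul 2
      · exact h1.const_mul v
      · exact h2.const_mul ((starRingEnd ℂ) v))
  simp only [Fin.sum_univ_three, Matrix.cons_val_zero, Matrix.cons_val_one, Matrix.cons_val] at hs
  have hpos := hs.re_nonneg (by
    exact (((hc _).const_smul (2 : ℂ)).add ((hc _).const_smul v)).add
      ((hc _).const_smul ((starRingEnd ℂ) v))) (by
    intro t
    set E := Complex.exp (Complex.I * (k * t : ℝ)) with hE
    have hsplit : ∀ n, Complex.exp (Complex.I * (((d n : ℝ) - k) * t : ℝ)) =
        (starRingEnd ℂ) E * Complex.exp (Complex.I * ((d n : ℝ) * t : ℝ)) := by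
      intro n
      rw [hE, ← Complex.exp_conj, map_mul, Complex.conj_I, Complex.conj_ofReal, ← Complex.exp_add]
      congr 1
      push_cast
      ring
    have hsplit' : ∀ n, Complex.exp (Complex.I * (((d n : ℝ) + k) * t : ℝ)) =
        E * Complex.exp (Complex.I * ((d n : ℝ) * t : ℝ)) := by
      intro n
      rw [hE, ← Complex.exp_add]
      congr 1
      push_cast
      ring
    simp only [hsplit, hsplit', mul_left_comm (β _), ← Finset.mul_sum]
    set F := ∑ n ∈ S, β n * Complex.exp (Complex.I * ((d n : ℝ) * t : ℝ)) with hF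
    have hreal : 2 * F + v * ((starRingEnd ℂ) E * F) + (starRingEnd ℂ) v * (E * F) =
        ((2 + 2 * (v * (starRingEnd ℂ) E).re : ℝ) : ℂ) * F := by
      have := Complex.add_conj (v * (starRingEnd ℂ) E)
      rw [map_mul, Complex.conj_conj] at this
      push_cast at this ⊢
      linear_combination F * this
    rw [hreal, Complex.re_ofReal_mul]
    refine mul_nonneg ?_ (h t)
    have hn : ‖v * (starRingEnd ℂ) E‖ = 1 := by
      rw [norm_mul, hv, RCLike.norm_conj, norm_exp_I_mul_real, one_mul]
    have := (abs_le.1 ((Complex.abs_re_le_norm _).trans hn.le)).1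
    linarith)
  have e1 : (∑ n ∈ S, if (d n : ℝ) - k = 0 then β n else 0) = g := by
    rw [hg, Finset.sum_filter]
    simp only [sub_eq_zero, Nat.cast_inj]
  have e2 : (∑ n ∈ S, if (d n : ℝ) + k = 0 then β n else 0) = 0 := by
    refine Finset.sum_eq_zero fun n _ => if_neg ?_
    have : (0 : ℝ) < k := Nat.cast_pos.2 (Nat.pos_of_ne_zero hk)
    positivity
  have e0 : (∑ n ∈ S, if (d n : ℝ) = 0 then β n else 0) = ∑ n ∈ S with d n = 0, β n := by
    rw [Finset.sum_filter]
    simp only [Nat.cast_eq_zero]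
  rw [e0, e1, e2, hvg, mul_zero, add_zero, Complex.add_re, Complex.neg_re, Complex.ofReal_re,
    show (2 : ℂ) = ((2 : ℝ) : ℂ) by norm_num, Complex.re_ofReal_mul] at hpos
  linarith

-- Twisting `χ` by `exp (i Ω(n) t)` keeps it a character and turns the divisor sum into a
-- trigonometric polynomial in `t` with frequencies `Ω n`. Its constant coefficient comes from `n =
-- 1` alone.
open ArithmeticFunction in
theorem IsToeplitzPos.norm_sum_cardFactors_le {b : ℕ → ℂ} (hb : IsToeplitzPos b) {χ : ℕ → ℂ}
    (hχ : IsUnimodularChar χ) {N : ℕ} (hN : N ≠ 0) {k : ℕ} (hk : k ≠ 0) :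
    ‖∑ n ∈ N.divisors with cardFactors n = k, (multipleDivisorsCard N n : ℂ) * b n * χ n‖ ≤
      2 * (N.divisors.card * (b 1).re) := by
  have h := norm_sum_filter_le_of_re_nonneg N.divisors
    (fun n => (multipleDivisorsCard N n : ℂ) * b n * χ n) (fun n => cardFactors n) ?_ hk
  · convert h using 2
    have : N.divisors.filter (fun n => cardFactors n = 0) = {1} := by
      ext n
      simp only [Finset.mem_filter, Nat.mem_divisors, cardFactors_eq_zero_iff_eq_zero_or_one,
        Finset.mem_singleton]
      constructor
      · rintro ⟨⟨h1, h2⟩, rfl | h3⟩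
        · exact absurd (zero_dvd_iff.1 h1) h2
        · exact h3
      · rintro rfl
        exact ⟨⟨one_dvd _, hN⟩, Or.inr rfl⟩
    rw [this, Finset.sum_singleton, hχ.one, mul_one]
    simp [multipleDivisorsCard]
  · intro t
    have := hb.re_sum_divisors_nonneg
      (χ := fun n => χ n * Complex.exp (Complex.I * (cardFactors n * t : ℝ))) ⟨?_, ?_⟩ N
    · simpa only [mul_assoc] using this
    · intro n hn
      rw [norm_mul, hχ.norm_eq n hn, norm_exp_I_mul_real, one_mul]
    · intro m n hm hn
      rw [hχ.mul m n hm hn, cardFactors_mul hm hn, mul_mul_mul_comm, ← Complex.exp_add]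
      congr 2
      push_cast
      ring

open ComplexConjugate in
/-- Parseval's inequality for Dirichlet polynomials. -/
theorem sum_norm_sq_le_of_dirichletPolynomial_le (S : Finset ℕ) (hS : ∀ n ∈ S, n ≠ 0)
    (β : ℕ → ℂ) {C : ℝ}
    (h : ∀ t : ℝ, ‖∑ n ∈ S, β n * Complex.exp (Complex.I * (Real.log n * t : ℝ))‖ ≤ C) :
    ∑ n ∈ S, ‖β n‖ ^ 2 ≤ C ^ 2 := by
  have hm := hasMean_trigSum (S ×ˢ S) (fun p => β p.1 * conj (β p.2))
    fun p => Real.log p.1 - Real.log p.2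
  have hle := hm.re_le (C := C ^ 2) (by fun_prop) (fun t => by
    have : ∑ p ∈ S ×ˢ S, β p.1 * conj (β p.2) *
        Complex.exp (Complex.I * ((Real.log p.1 - Real.log p.2) * t : ℝ)) =
        (Complex.normSq (∑ n ∈ S, β n * Complex.exp (Complex.I * (Real.log n * t : ℝ))) : ℝ) := by
      rw [Complex.normSq_eq_conj_mul_self, map_sum, mul_comm, Finset.sum_mul_sum,
        Finset.sum_product]
      refine Finset.sum_congr rfl fun m _ => Finset.sum_congr rfl fun l _ => ?_
      have hconj : conj (Complex.exp (Complex.I * (Real.log l * t : ℝ))) =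
          Complex.exp (-(Complex.I * (Real.log l * t : ℝ))) := by
        rw [← Complex.exp_conj, map_mul, Complex.conj_I, Complex.conj_ofReal, neg_mul]
      rw [map_mul, hconj, mul_mul_mul_comm, ← Complex.exp_add]
      congr 2
      push_cast
      ring
    rw [this, Complex.ofReal_re, Complex.normSq_eq_norm_sq]
    exact pow_le_pow_left₀ (norm_nonneg _) (h t) 2)
  refine le_of_eq_of_le ?_ hle
  rw [Finset.sum_product, Complex.re_sum]
  refine Finset.sum_congr rfl fun m hmS => ?_
  rw [Finset.sum_eq_single_of_mem m hmS]
  · rw [sub_self, if_pos rfl, Complex.mul_conj, Complex.normSq_eq_norm_sq, Complex.ofReal_re]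
  · intro l hl hlm
    refine if_neg fun h0 => hlm ?_
    have : (m : ℝ) = l := Real.log_injOn_pos (Set.mem_Ioi.2 (Nat.cast_pos.2 (Nat.pos_of_ne_zero (hS m hmS))))
      (Set.mem_Ioi.2 (Nat.cast_pos.2 (Nat.pos_of_ne_zero (hS l hl)))) (sub_eq_zero.1 h0)
    exact (Nat.cast_injective this).symm

theorem isUnimodularChar_exp_log (t : ℝ) :
    IsUnimodularChar fun n => Complex.exp (Complex.I * (Real.log n * t : ℝ)) where
  norm_eq _ _ := norm_exp_I_mul_real _
  mul m n hm hn := by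
    rw [Nat.cast_mul, Real.log_mul (Nat.cast_ne_zero.2 hm) (Nat.cast_ne_zero.2 hn),
      ← Complex.exp_add]
    congr 1
    push_cast
    ring

theorem isUnimodularChar_factorization_prod {u : ℕ → ℂ} (hu : ∀ p, ‖u p‖ = 1) :
    IsUnimodularChar fun n => n.factorization.prod fun p k => u p ^ k where
  norm_eq n _ := by
    simp only [Finsupp.prod, norm_prod, norm_pow, hu, one_pow, Finset.prod_const_one]
  mul m n hm hn := by
    simp only [Nat.factorization_mul hm hn]
    exact Finsupp.prod_add_index' (fun _ => pow_zero _) fun _ _ _ => pow_add _ _ _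

open ArithmeticFunction

/-- The bound is uniform over the characters `n ^ (i t)`, so Parseval applies. -/
theorem IsToeplitzPos.sum_divisors_norm_sq_le {b : ℕ → ℂ} (hb : IsToeplitzPos b) {N : ℕ}
    (hN : N ≠ 0) {k : ℕ} (hk : k ≠ 0) :
    ∑ n ∈ N.divisors with cardFactors n = k, ((multipleDivisorsCard N n : ℝ) * ‖b n‖) ^ 2 ≤
      (2 * (N.divisors.card * (b 1).re)) ^ 2 := by
  have h := sum_norm_sq_le_of_dirichletPolynomial_le
    (N.divisors.filter fun n => cardFactors n = k)
    (fun n hn => (Nat.pos_of_mem_divisors (Finset.mem_of_mem_filter n hn)).ne')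
    (fun n => (multipleDivisorsCard N n : ℂ) * b n)
    fun t => hb.norm_sum_cardFactors_le (isUnimodularChar_exp_log t) hN hk
  simpa only [norm_mul, Complex.norm_natCast] using h

/-- A character takes arbitrary unimodular values at primes, so one choice aligns the phases of all
the terms with `Ω n = 1`. -/
theorem IsToeplitzPos.sum_divisors_prime_norm_le {b : ℕ → ℂ} (hb : IsToeplitzPos b) {N : ℕ}
    (hN : N ≠ 0) :
    ∑ n ∈ N.divisors with cardFactors n = 1, (multipleDivisorsCard N n : ℝ) * ‖b n‖ ≤
      2 * (N.divisors.card * (b 1).re) := by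
  choose u hu hub using fun n : ℕ => RCLike.exists_norm_eq_mul_self (b n)
  have h := hb.norm_sum_cardFactors_le (isUnimodularChar_factorization_prod hu) hN one_ne_zero
  refine le_of_eq_of_le ?_ h
  have : ∀ n ∈ N.divisors.filter (fun n => cardFactors n = 1),
      (multipleDivisorsCard N n : ℂ) * b n * (n.factorization.prod fun p k => u p ^ k) =
        (((multipleDivisorsCard N n : ℝ) * ‖b n‖ : ℝ) : ℂ) := by
    intro n hn
    have hp : n.Prime := cardFactors_eq_one_iff_prime.1 (Finset.mem_filter.1 hn).2
    have hprod : (n.factorization.prod fun p k => u p ^ k) = u n := by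
      rw [hp.factorization]
      simp
    rw [hprod, mul_assoc, mul_comm (b n), ← hub n]
    push_cast
    rfl
  rw [Finset.sum_congr rfl this, ← Complex.ofReal_sum, Complex.norm_real, Real.norm_of_nonneg]
  positivity

/-! ### Removing the divisor weights -/

theorem card_divisors_pow_le_multipleDivisorsCard {P n : ℕ} (hP : P ≠ 0) (hn : n ∣ P) (E : ℕ) :
    (P ^ E).divisors.card ≤ multipleDivisorsCard (P ^ (E + 1)) n := by
  have hn0 : n ≠ 0 := ne_zero_of_dvd_ne_zero hP hn
  refine Finset.card_le_card_of_injOn (· * n) (fun m hm => ?_) fun m _ l _ h => ?_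
  · simp only [Finset.coe_filter, Set.mem_ofPred_eq, Nat.mem_divisors, Finset.mem_coe] at hm ⊢
    exact ⟨⟨pow_succ P E ▸ mul_dvd_mul hm.1 hn, pow_ne_zero _ hP⟩, dvd_mul_left _ _⟩
  · exact Nat.eq_of_mul_eq_mul_right (Nat.pos_of_ne_zero hn0) h

theorem tendsto_card_divisors_pow_ratio {P : ℕ} (hP : P ≠ 0) :
    Tendsto (fun E : ℕ => ((P ^ E).divisors.card : ℝ) / (P ^ (E + 1)).divisors.card) atTop
      (𝓝 1) := by
  have hcard : ∀ E : ℕ, E ≠ 0 → ((P ^ E).divisors.card : ℝ) =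
      ∏ p ∈ P.primeFactors, ((E : ℝ) * P.factorization p + 1) := by
    intro E hE
    rw [Nat.card_divisors (pow_ne_zero _ hP), Nat.primeFactors_pow _ hE]
    simp
  have hlim : Tendsto (fun E : ℕ => ∏ p ∈ P.primeFactors,
      (((E : ℝ) * P.factorization p + 1) / (((E + 1 : ℕ) : ℝ) * P.factorization p + 1))) atTop
      (𝓝 (∏ p ∈ P.primeFactors, 1)) := by
    refine tendsto_finsetProd _ fun p _ => ?_
    have h1 : Tendsto (fun E : ℕ => (1 : ℝ) / ((E : ℝ) + 1)) atTop (𝓝 0) :=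
      tendsto_one_div_add_atTop_nhds_zero_nat
    -- Each factor lies between `E / (E + 1)` and `1`.
    refine tendsto_of_tendsto_of_tendsto_of_le_of_le (g := fun E : ℕ => 1 - (1 : ℝ) / (E + 1))
      (by simpa using h1.const_sub 1) tendsto_const_nhds (fun E => ?_) fun E => ?_
    · have hv : (0 : ℝ) ≤ P.factorization p := Nat.cast_nonneg _
      have hE : (0 : ℝ) ≤ E := Nat.cast_nonneg _
      simp only
      push_cast
      rw [le_div_iff₀ (by positivity), one_sub_div (by positivity), div_mul_eq_mul_div,
        div_le_iff₀ (by positivity)]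
      nlinarith
    · have hv : (0 : ℝ) ≤ P.factorization p := Nat.cast_nonneg _
      refine div_le_one_of_le₀ ?_ (by positivity)
      push_cast
      nlinarith
  rw [Finset.prod_const_one] at hlim
  refine hlim.congr' ?_
  filter_upwards [eventually_ne_atTop 0] with E hE
  rw [hcard E hE, hcard (E + 1) E.succ_ne_zero, Finset.prod_div_distrib]

theorem subset_filter_divisors_prod_pow {T : Finset ℕ} (hT : ∀ n ∈ T, n ≠ 0) {k : ℕ}
    (hTk : ∀ n ∈ T, cardFactors n = k) (E : ℕ) :
    T ⊆ ((∏ n ∈ T, n) ^ (E + 1)).divisors.filter fun n => cardFactors n = k := by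
  intro n hn
  rw [Finset.mem_filter, Nat.mem_divisors]
  exact ⟨⟨(Finset.dvd_prod_of_mem (fun n => n) hn).trans (dvd_pow_self _ E.succ_ne_zero),
    pow_ne_zero _ (Finset.prod_ne_zero_iff.2 hT)⟩, hTk n hn⟩

/-- The `k`-homogeneous part has `ℓ²` norm at most `2 Re b_1`. -/
theorem IsToeplitzPos.sum_norm_sq_le {b : ℕ → ℂ} (hb : IsToeplitzPos b) {T : Finset ℕ}
    (hT : ∀ n ∈ T, n ≠ 0) {k : ℕ} (hk : k ≠ 0) (hTk : ∀ n ∈ T, cardFactors n = k) :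
    ∑ n ∈ T, ‖b n‖ ^ 2 ≤ (2 * (b 1).re) ^ 2 := by
  set P := ∏ n ∈ T, n
  have hP : P ≠ 0 := Finset.prod_ne_zero_iff.2 hT
  have hlim := ((tendsto_card_divisors_pow_ratio hP).pow 2).mul_const (∑ n ∈ T, ‖b n‖ ^ 2)
  rw [one_pow, one_mul] at hlim
  -- With `N = P ^ (E + 1)`, every `n ∈ T` has relative weight at least `d(P ^ E) / d(P ^ (E + 1))`,
  -- where `d` counts divisors; this tends to `1`.
  refine le_of_tendsto' hlim fun E => ?_
  have hN : P ^ (E + 1) ≠ 0 := pow_ne_zero _ hP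
  have hpos : (0 : ℝ) < (P ^ (E + 1)).divisors.card :=
    Nat.cast_pos.2 (Finset.card_pos.2 ⟨1, Nat.one_mem_divisors.2 hN⟩)
  have h1 : ∑ n ∈ T, (((P ^ E).divisors.card : ℝ) * ‖b n‖) ^ 2 ≤
      (2 * ((P ^ (E + 1)).divisors.card * (b 1).re)) ^ 2 := by
    refine le_trans ?_ ((Finset.sum_le_sum_of_subset_of_nonneg
      (subset_filter_divisors_prod_pow hT hTk E) fun _ _ _ => by positivity).trans
        (hb.sum_divisors_norm_sq_le hN hk))
    refine Finset.sum_le_sum fun n hn => ?_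
    have := card_divisors_pow_le_multipleDivisorsCard hP
      (Finset.dvd_prod_of_mem (fun n => n) hn) E
    gcongr
  simp only [mul_pow, ← Finset.mul_sum] at h1 ⊢
  rw [div_pow, div_mul_eq_mul_div, div_le_iff₀ (by positivity)]
  linarith

/-- The `1`-homogeneous part has `ℓ¹` norm at most `2 Re b_1`. -/
theorem IsToeplitzPos.sum_prime_norm_le {b : ℕ → ℂ} (hb : IsToeplitzPos b) {T : Finset ℕ}
    (hTk : ∀ n ∈ T, cardFactors n = 1) :
    ∑ n ∈ T, ‖b n‖ ≤ 2 * (b 1).re := by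
  have hT : ∀ n ∈ T, n ≠ 0 := fun n hn => (cardFactors_eq_one_iff_prime.1 (hTk n hn)).ne_zero
  set P := ∏ n ∈ T, n
  have hP : P ≠ 0 := Finset.prod_ne_zero_iff.2 hT
  have hlim := (tendsto_card_divisors_pow_ratio hP).mul_const (∑ n ∈ T, ‖b n‖)
  rw [one_mul] at hlim
  refine le_of_tendsto' hlim fun E => ?_
  have hN : P ^ (E + 1) ≠ 0 := pow_ne_zero _ hP
  have hpos : (0 : ℝ) < (P ^ (E + 1)).divisors.card :=
    Nat.cast_pos.2 (Finset.card_pos.2 ⟨1, Nat.one_mem_divisors.2 hN⟩)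
  have h1 : ∑ n ∈ T, ((P ^ E).divisors.card : ℝ) * ‖b n‖ ≤
      2 * ((P ^ (E + 1)).divisors.card * (b 1).re) := by
    refine le_trans ?_ ((Finset.sum_le_sum_of_subset_of_nonneg
      (subset_filter_divisors_prod_pow hT hTk E) fun _ _ _ => by positivity).trans
        (hb.sum_divisors_prime_norm_le hN))
    refine Finset.sum_le_sum fun n hn => ?_
    have := card_divisors_pow_le_multipleDivisorsCard hP
      (Finset.dvd_prod_of_mem (fun n => n) hn) E
    gcongr
  rw [← Finset.mul_sum] at h1
  rw [div_mul_eq_mul_div, div_le_iff₀ hpos]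
  linarith

/-! ### Cubic weights and an Euler product -/

theorem two_pow_cardFactors_le {n : ℕ} (hn : n ≠ 0) : 2 ^ cardFactors n ≤ n := by
  induction n using Nat.recOnMul with
  | zero => exact absurd rfl hn
  | one => simp
  | prime p hp => simpa [cardFactors_apply_prime hp] using hp.two_le
  | mul a b ha hb =>
    have ha0 := left_ne_zero_of_mul hn
    have hb0 := right_ne_zero_of_mul hn
    rw [cardFactors_mul ha0 hb0, pow_add]
    exact Nat.mul_le_mul (ha ha0) (hb hb0)

/-- The completely multiplicative function which vanishes on even numbers and equals
`(2 ^ Ω n / n) ^ 3` on odd numbers. -/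
noncomputable def oddCubeWeight : ℕ →*₀ ℝ where
  toFun n := if Even n then 0 else ((2 : ℝ) ^ cardFactors n / n) ^ 3
  map_zero' := by simp
  map_one' := by simp
  map_mul' m n := by
    by_cases hm : Even m
    · simp [hm]
    by_cases hn : Even n
    · simp [hn]
    have hm0 : m ≠ 0 := by rintro rfl; exact hm Even.zero
    have hn0 : n ≠ 0 := by rintro rfl; exact hn Even.zero
    have hmn : ¬ Even (m * n) := by simp [Nat.even_mul, hm, hn]
    rw [if_neg hm, if_neg hn, if_neg hmn, cardFactors_mul hm0 hn0, pow_add, Nat.cast_mul,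
      mul_div_mul_comm, mul_pow]

theorem oddCubeWeight_apply (n : ℕ) :
    oddCubeWeight n = if Even n then 0 else ((2 : ℝ) ^ cardFactors n / n) ^ 3 := rfl

theorem oddCubeWeight_of_odd {n : ℕ} (hn : Odd n) :
    oddCubeWeight n = ((2 : ℝ) ^ cardFactors n / n) ^ 3 := by
  rw [oddCubeWeight_apply, if_neg (Nat.not_even_iff_odd.2 hn)]

theorem oddCubeWeight_two : oddCubeWeight 2 = 0 := by
  rw [oddCubeWeight_apply, if_pos even_two]

theorem oddCubeWeight_prime {p : ℕ} (hp : p.Prime) (h2 : p ≠ 2) :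
    oddCubeWeight p = 8 / (p : ℝ) ^ 3 := by
  rw [oddCubeWeight_of_odd (hp.odd_of_ne_two h2), cardFactors_apply_prime hp, pow_one, div_pow]
  norm_num

theorem oddCubeWeight_nonneg (n : ℕ) : 0 ≤ oddCubeWeight n := by
  rw [oddCubeWeight_apply]
  split_ifs <;> positivity

theorem oddCubeWeight_prime_lt_one {p : ℕ} (hp : p.Prime) : oddCubeWeight p < 1 := by
  by_cases h2 : p = 2
  · rw [h2, oddCubeWeight_two]
    exact one_pos
  · rw [oddCubeWeight_prime hp h2]
    have h3 : 3 ≤ p := by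
      have := hp.two_le
      omega
    have h3' : (3 : ℝ) ≤ p := by exact_mod_cast h3
    rw [div_lt_one (by positivity)]
    have : (3 : ℝ) ^ 3 ≤ (p : ℝ) ^ 3 := pow_le_pow_left₀ (by norm_num) h3' 3
    linarith

/-- The correction `4 / (N - 1) ^ 2` majorizes the tail of `∑ 8 / n ^ 3` and makes the induction
close; a bare bound by `2` would not propagate. -/
theorem prod_primesBelow_oddCubeWeight_le {N : ℕ} (hN : 8 ≤ N) :
    ∏ p ∈ N.primesBelow, (1 - oddCubeWeight p)⁻¹ ≤ 2 * (1 - 4 / ((N : ℝ) - 1) ^ 2) := by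
  induction N, hN using Nat.le_induction with
  | base =>
    have : Nat.primesBelow 8 = {2, 3, 5, 7} := by decide
    rw [this, Finset.prod_insert (by decide), Finset.prod_insert (by decide),
      Finset.prod_insert (by decide), Finset.prod_singleton, oddCubeWeight_two,
      oddCubeWeight_prime Nat.prime_three (by decide),
      oddCubeWeight_prime Nat.prime_five (by decide),
      oddCubeWeight_prime (by decide : Nat.Prime 7) (by decide)]
    norm_num
  | succ N hN ih =>
    have hN' : (8 : ℝ) ≤ N := by exact_mod_cast hN
    have hmono : 4 / (N : ℝ) ^ 2 + 8 / (N : ℝ) ^ 3 ≤ 4 / ((N : ℝ) - 1) ^ 2 := by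
      have : 4 / (N : ℝ) ^ 2 + 8 / (N : ℝ) ^ 3 = 4 * (N + 2) / (N : ℝ) ^ 3 := by
        field_simp
        ring
      have h1 : (0 : ℝ) < (N : ℝ) - 1 := by linarith
      rw [this, div_le_div_iff₀ (by positivity) (by positivity)]
      nlinarith
    have h8 : 0 ≤ 8 / (N : ℝ) ^ 3 := by positivity
    rw [Nat.primesBelow_succ]
    push_cast
    rw [add_sub_cancel_right]
    split_ifs with hp
    · rw [Finset.prod_insert (Nat.notMem_primesBelow N)]
      have hlt := oddCubeWeight_prime_lt_one hp
      rw [oddCubeWeight_prime hp (by omega)] at hlt ⊢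
      rw [inv_mul_le_iff₀ (sub_pos.2 hlt)]
      refine ih.trans ?_
      have h4 : 0 ≤ 4 / (N : ℝ) ^ 2 := by positivity
      nlinarith [mul_nonneg h8 h4]
    · refine ih.trans ?_
      linarith

theorem sum_oddCubeWeight_le (S : Finset ℕ) : ∑ m ∈ S, oddCubeWeight m ≤ 2 := by
  obtain ⟨N, hN8, hN⟩ : ∃ N, 8 ≤ N ∧ ∀ m ∈ S, m < N :=
    ⟨S.sup id + 8, by omega, fun m hm => by
      have : m ≤ S.sup id := Finset.le_sup (f := id) hm
      omega⟩
  have hsum : HasSum (fun m : N.smoothNumbers => oddCubeWeight m)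
      (∏ p ∈ N.primesBelow, (1 - oddCubeWeight p)⁻¹) := (EulerProduct.summable_and_hasSum_smoothNumbers_prod_primesBelow_geometric
    (f := (oddCubeWeight : ℕ →* ℝ)) (fun {p} hp => by
      exact (Real.norm_of_nonneg (oddCubeWeight_nonneg p)).trans_lt <| oddCubeWeight_prime_lt_one hp) N).2
  rw [← Finset.sum_filter_add_sum_filter_not S (fun m => m = 0)]
  have h0 : ∑ m ∈ S with m = 0, oddCubeWeight m = 0 :=
    Finset.sum_eq_zero fun m hm => by rw [(Finset.mem_filter.1 hm).2, _root_.map_zero]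
  have hmem : ∀ m ∈ S.filter (fun m => ¬ m = 0), m ∈ N.smoothNumbers := fun m hm =>
    Nat.mem_smoothNumbers_of_lt (Nat.pos_of_ne_zero (Finset.mem_filter.1 hm).2)
      (hN m (Finset.mem_filter.1 hm).1)
  rw [h0, zero_add, ← Finset.sum_subtype_of_mem (p := (· ∈ N.smoothNumbers)) oddCubeWeight hmem]
  refine (sum_le_hasSum (f := fun m : N.smoothNumbers => oddCubeWeight m) _ (fun m _ => oddCubeWeight_nonneg m) hsum).trans
    ((prod_primesBelow_oddCubeWeight_le hN8).trans ?_)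
  have : 0 ≤ 4 / ((N : ℝ) - 1) ^ 2 := by positivity
  linarith

/-- Writing `n = 2 ^ v * m` with `m` odd, the ratio `2 ^ Ω n / n` ignores the power of `2`, and for
fixed `k` the odd part determines `n`. The sum is thus one over distinct odd `m`, bounded by the
Euler product over odd primes. The prime `2`, excluded here, would have weight `1` and a divergent
factor. -/
theorem sum_cube_two_pow_div_le {T : Finset ℕ} (hT : ∀ n ∈ T, n ≠ 0) {k : ℕ}
    (hTk : ∀ n ∈ T, cardFactors n = k) :
    ∑ n ∈ T, ((2 : ℝ) ^ k / n) ^ 3 ≤ 2 := by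
  have hex : ∀ n : ℕ, ∃ v m : ℕ, n ≠ 0 → Odd m ∧ n = 2 ^ v * m := fun n => by
    by_cases hn : n = 0
    · exact ⟨0, 0, fun h => absurd hn h⟩
    · obtain ⟨v, m, h⟩ := Nat.exists_eq_two_pow_mul_odd hn
      exact ⟨v, m, fun _ => h⟩
  choose v m hvm using hex
  have hm0 : ∀ n ∈ T, m n ≠ 0 := fun n hn => (hvm n (hT n hn)).1.pos.ne'
  have hk : ∀ n ∈ T, v n + cardFactors (m n) = k := by
    intro n hn
    have h := hTk n hn
    rw [(hvm n (hT n hn)).2, cardFactors_mul (by positivity) (hm0 n hn),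
      cardFactors_apply_prime_pow Nat.prime_two] at h
    exact h
  have hinj : Set.InjOn m T := by
    intro n hn l hl h
    have h1 := hk n hn
    have h2 := hk l hl
    rw [h] at h1
    rw [(hvm n (hT n hn)).2, (hvm l (hT l hl)).2, h, show v n = v l by omega]
  refine le_trans (le_of_eq ?_) (sum_oddCubeWeight_le (T.image m))
  rw [Finset.sum_image hinj]
  refine Finset.sum_congr rfl fun n hn => ?_
  rw [oddCubeWeight_of_odd (hvm n (hT n hn)).1, ← hk n hn]
  congr 1
  have hmr : (m n : ℝ) ≠ 0 := Nat.cast_ne_zero.2 (hm0 n hn)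
  have hnr : (n : ℝ) = 2 ^ v n * m n := by
    have := congrArg (Nat.cast (R := ℝ)) (hvm n (hT n hn)).2
    push_cast at this
    exact this
  rw [hnr, pow_add, mul_div_mul_left _ _ (by positivity)]

/-! ### Numerical estimates and the weighted `ℓ¹` bound -/

theorem two_rpow_lower_bound : (329 / 100 : ℝ) ≤ 2 ^ (1.72 : ℝ) := by
  rw [← pow_le_pow_iff_left₀ (by norm_num) (by positivity) (by norm_num : 25 ≠ 0),
    ← Real.rpow_natCast (_ ^ (1.72 : ℝ)), ← Real.rpow_mul (by norm_num)]
  rw [show (1.72 : ℝ) * (25 : ℕ) = (43 : ℕ) by norm_num, Real.rpow_natCast]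
  norm_num

theorem inv_rpow_le {n : ℕ} (hn : n ≠ 0) (k : ℕ) :
    ((n : ℝ) ^ (1.72 : ℝ))⁻¹ ≤ (100 / 329 : ℝ) ^ k * ((2 : ℝ) ^ k / n) ^ (1.72 : ℝ) := by
  have hnr : (0 : ℝ) < n := Nat.cast_pos.2 (Nat.pos_of_ne_zero hn)
  have h1 : (329 / 100 : ℝ) ^ k ≤ ((2 : ℝ) ^ k) ^ (1.72 : ℝ) := by
    rw [← Real.rpow_natCast 2 k, ← Real.rpow_mul (by norm_num), mul_comm, Real.rpow_mul (by norm_num),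
      Real.rpow_natCast]
    exact pow_le_pow_left₀ (by norm_num) two_rpow_lower_bound k
  rw [Real.div_rpow (by positivity) hnr.le, ← mul_div_assoc, inv_eq_one_div]
  gcongr
  calc (1 : ℝ) = (100 / 329) ^ k * (329 / 100) ^ k := by
        rw [← mul_pow]
        norm_num
    _ ≤ _ := by gcongr

theorem IsToeplitzPos.sum_homogeneous_le {b : ℕ → ℂ} (hb : IsToeplitzPos b) (h0 : 0 ≤ (b 1).re)
    {T : Finset ℕ} (hT : ∀ n ∈ T, n ≠ 0) {k : ℕ} (hk : k ≠ 0)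
    (hTk : ∀ n ∈ T, cardFactors n = k) :
    ∑ n ∈ T, ‖b n‖ / (n : ℝ) ^ (1.72 : ℝ) ≤ 17 / 6 * (b 1).re * (100 / 329) ^ k := by
  have hw : ∑ n ∈ T, ((n : ℝ) ^ (1.72 : ℝ))⁻¹ ^ 2 ≤ ((100 / 329 : ℝ) ^ k) ^ 2 * 2 := by
    refine le_trans ?_ (mul_le_mul_of_nonneg_left (sum_cube_two_pow_div_le hT hTk)
      (sq_nonneg ((100 / 329 : ℝ) ^ k)))
    rw [Finset.mul_sum]
    refine Finset.sum_le_sum fun n hn => ?_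
    have hnr : (0 : ℝ) < n := Nat.cast_pos.2 (Nat.pos_of_ne_zero (hT n hn))
    have hr : (2 : ℝ) ^ k / n ≤ 1 := by
      rw [div_le_one hnr, ← hTk n hn]
      exact_mod_cast two_pow_cardFactors_le (hT n hn)
    refine (pow_le_pow_left₀ (by positivity)
      (inv_rpow_le (hT n hn) k) 2).trans ?_
    rw [mul_pow, ← Real.rpow_natCast (_ ^ (1.72 : ℝ)), ← Real.rpow_mul (by positivity),
      ← Real.rpow_natCast _ 3]
    -- The exponent `2 * 1.72 = 3.44` may be lowered to `3` because `2 ^ k / n ≤ 1`.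
    exact mul_le_mul_of_nonneg_left
      (Real.rpow_le_rpow_of_exponent_ge (by positivity) hr (by norm_num)) (by positivity)
  have hcs := Finset.sum_mul_sq_le_sq_mul_sq T (fun n => ‖b n‖)
    fun n => ((n : ℝ) ^ (1.72 : ℝ))⁻¹
  -- Cauchy-Schwarz gives the constant `2√2`; it is replaced by `17 / 6`, whose square `289 / 36`
  -- exceeds `8`.
  refine abs_le_of_sq_le_sq' ?_ (by positivity) |>.2
  simp only [div_eq_mul_inv] at hcs ⊢
  refine hcs.trans ((mul_le_mul (hb.sum_norm_sq_le hT hk hTk) hw (by positivity)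
    (by positivity)).trans ?_)
  have : 0 ≤ ((b 1).re * (100 * 329⁻¹) ^ k) ^ 2 := sq_nonneg _
  rw [div_eq_mul_inv]
  linarith

/-- With `q = 100 / 329`, the fraction `10000 / 75341` is `q ^ 2 / (1 - q)`, so the subtracted term
is the exact tail of the series. The total `2 q + 17 / 6 * q ^ 2 / (1 - q)` is about `0.984`. -/
theorem sum_range_geometric_bound (K : ℕ) :
    ∑ k ∈ Finset.range (K + 2),
      (if k = 0 then 0 else if k = 1 then 200 / 329 else 17 / 6 * (100 / 329 : ℝ) ^ k) ≤
      99 / 100 - 17 / 6 * (10000 / 75341) * (100 / 329) ^ K := by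
  induction K with
  | zero => norm_num [Finset.sum_range_succ]
  | succ K ih =>
    rw [Finset.sum_range_succ, if_neg (by omega), if_neg (by omega)]
    refine (add_le_add_left ih _).trans (le_of_eq ?_)
    ring

/-- A bound for weighted `ℓ¹` norms of the coefficients, with a constant smaller than `1`. -/
theorem IsToeplitzPos.sum_le {b : ℕ → ℂ} (hb : IsToeplitzPos b)
    (T : Finset ℕ) (hT : ∀ n ∈ T, 2 ≤ n) :
    ∑ n ∈ T, ‖b n‖ / (n : ℝ) ^ (1.72 : ℝ) ≤ 99 / 100 * (b 1).re := by
  have h0 : 0 ≤ (b 1).re := by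
    have := hb.sum_prime_norm_le (T := ∅) (by simp)
    simpa using this
  have hT0 : ∀ n ∈ T, n ≠ 0 := fun n hn => by
    have := hT n hn
    omega
  set K := T.sup cardFactors
  have hmaps : ∀ n ∈ T, cardFactors n ∈ Finset.range (K + 2) := fun n hn => by
    have : cardFactors n ≤ K := Finset.le_sup (f := cardFactors) hn
    rw [Finset.mem_range]
    omega
  rw [← Finset.sum_fiberwise_of_maps_to hmaps]
  have hterm : ∀ k ∈ Finset.range (K + 2),
      ∑ n ∈ T with cardFactors n = k, ‖b n‖ / (n : ℝ) ^ (1.72 : ℝ) ≤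
      (if k = 0 then 0 else if k = 1 then 200 / 329 else 17 / 6 * (100 / 329 : ℝ) ^ k) *
        (b 1).re := by
    intro k _
    have hk' : ∀ n ∈ T.filter (fun n => cardFactors n = k), cardFactors n = k :=
      fun n hn => (Finset.mem_filter.1 hn).2
    split_ifs with hk0 hk1
    · subst hk0
      rw [zero_mul]
      refine Finset.sum_nonpos fun n hn => ?_
      have := hT n (Finset.mem_of_mem_filter n hn)
      rcases cardFactors_eq_zero_iff_eq_zero_or_one.1 (hk' n hn) with h | h <;> omega
    · subst hk1
      refine le_trans ?_ (mul_le_mul_of_nonneg_left (hb.sum_prime_norm_le hk')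
        (by norm_num : (0 : ℝ) ≤ 100 / 329)) |>.trans (le_of_eq (by ring))
      rw [Finset.mul_sum]
      refine Finset.sum_le_sum fun n hn => ?_
      have hn2 : (2 : ℝ) ≤ n := by exact_mod_cast hT n (Finset.mem_of_mem_filter n hn)
      have h329 : (329 / 100 : ℝ) ≤ (n : ℝ) ^ (1.72 : ℝ) :=
        two_rpow_lower_bound.trans (Real.rpow_le_rpow (by norm_num) hn2 (by norm_num))
      rw [div_le_iff₀ (by linarith)]
      nlinarith [norm_nonneg (b n)]
    · refine (hb.sum_homogeneous_le h0 (fun n hn => hT0 n (Finset.mem_of_mem_filter n hn)) hk0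
        hk').trans (le_of_eq (by ring))
  refine (Finset.sum_le_sum hterm).trans ?_
  rw [← Finset.sum_mul]
  refine mul_le_mul_of_nonneg_right ((sum_range_geometric_bound K).trans ?_) h0
  have : (0 : ℝ) ≤ 17 / 6 * (10000 / 75341) * (100 / 329) ^ K := by positivity
  linarith

/-! ### Reduction of the domain to a half-plane -/

theorem HasDirichletMeans.const_sub_mul {a : ℕ → ℂ} {f : ℂ → ℂ} {σ : ℝ}
    (h : HasDirichletMeans a f σ) (u c : ℂ) :
    HasDirichletMeans (fun n => (if n = 1 then c else 0) - u * a n) (fun s => c - u * f s) σ := by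
  refine ⟨continuous_const.sub (h.1.const_smul u), fun x => ?_⟩
  have hc : Continuous fun t : ℝ => f (σ + t * Complex.I) * Complex.exp (Complex.I * (x * t : ℝ)) :=
    h.1.mul (continuous_exp_I_mul x)
  have h1 := HasMean.finset_sum (Finset.univ : Finset (Fin 2))
    (φ := ![fun t => c * Complex.exp (Complex.I * (x * t : ℝ)),
      fun t => -u * (f (σ + t * Complex.I) * Complex.exp (Complex.I * (x * t : ℝ)))])
    (L := ![_, _])
    (by
      intro i _
      fin_cases i
      · exact (continuous_exp_I_mul x).const_smul c
      · exact hc.const_smul (-u))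
    (by
      intro i _
      fin_cases i
      · exact (hasMean_exp x).const_mul c
      · exact (h.2 x).const_mul (-u))
  simp only [Fin.sum_univ_two, Matrix.cons_val_zero, Matrix.cons_val_one] at h1
  convert h1 using 2 with t
  · ring
  · have hinj : ∀ n m : ℕ, Real.log (n + 1 : ℕ) = x → Real.log (m + 1 : ℕ) = x → n = m := by
      intro n m hn hm
      have := Real.log_injOn_pos (Set.mem_Ioi.2 (Nat.cast_pos.2 n.succ_pos))
        (Set.mem_Ioi.2 (Nat.cast_pos.2 m.succ_pos)) (hn.trans hm.symm)
      exact Nat.succ_injective (Nat.cast_injective this)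
    -- At most one term of the series has frequency `x`, so no summability is needed; the constant
    -- `c` matters only for `x = 0`, that is, for `n = 1`.
    by_cases hx : ∃ n : ℕ, Real.log (n + 1 : ℕ) = x
    · obtain ⟨m, hm⟩ := hx
      have hne : ∀ n, n ≠ m → ¬ Real.log (n + 1 : ℕ) = x := fun n hn h => hn (hinj n m h hm)
      rw [tsum_eq_single m fun n hn => if_neg (hne n hn),
        tsum_eq_single m fun n hn => if_neg (hne n hn), if_pos hm, if_pos hm]
      by_cases hm0 : m = 0
      · subst hm0
        have hx0 : x = 0 := by
          rw [← hm]
          simp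
        simp only [hx0, zero_add, if_true, Nat.cast_one, Complex.one_cpow, div_one]
        ring
      · have hx0 : x ≠ 0 := by
          rintro rfl
          exact hm0 (hinj m 0 hm (by simp))
        simp only [if_neg hx0, if_neg (show ¬ m + 1 = 1 by omega)]
        ring
    · push Not at hx
      have hx0 : x ≠ 0 := fun h => hx 0 (by simp [h])
      simp only [if_neg (hx _), if_neg hx0, tsum_zero, mul_zero, add_zero]

/-- A supporting half-plane, with unit normal, at a boundary point of an open convex set. -/
theorem exists_supporting_halfPlane {K : Set ℂ} (hK : IsOpen K) (hconv : Convex ℝ K)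
    (hne : K.Nonempty) {w : ℂ} (hw : w ∉ K) :
    ∃ u : ℂ, ‖u‖ = 1 ∧ ∀ z ∈ K, (u * z).re < (u * w).re := by
  obtain ⟨g, hg⟩ := RCLike.geometric_hahn_banach_open_point (𝕜 := ℂ) hconv hK hw
  have hgz : ∀ z, g z = g 1 * z := fun z => by
    have := g.map_smul z 1
    rw [smul_eq_mul, mul_one, smul_eq_mul] at this
    rw [this, mul_comm]
  have hv : g 1 ≠ 0 := by
    obtain ⟨z, hz⟩ := hne
    intro h
    have := hg z hz
    rw [hgz z, hgz w, h, zero_mul, zero_mul] at this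
    exact lt_irrefl _ this
  have hpos : 0 < ‖g 1‖ := norm_pos_iff.2 hv
  refine ⟨((‖g 1‖⁻¹ : ℝ) : ℂ) * g 1, ?_, fun z hz => ?_⟩
  · rw [norm_mul, Complex.norm_real, Real.norm_of_nonneg (by positivity),
      inv_mul_cancel₀ hpos.ne']
  · have := hg z hz
    rw [hgz z, hgz w] at this
    rw [mul_assoc, mul_assoc, Complex.re_ofReal_mul, Complex.re_ofReal_mul]
    exact mul_lt_mul_of_pos_left this (by positivity)

/-- The exponent splits as `0.0067 + 1.72`: the first part moves to a line inside `Π` where the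
means are available, the second is the exponent of `IsToeplitzPos.sum_le`. -/
theorem bohrInequality_of_hasDirichletMeans {G : Set ℂ} (hG : IsOpen G) (hne : G.Nonempty)
    (huniv : convexHull ℝ G ≠ Set.univ) {f : ℂ → ℂ} {a : ℕ → ℂ} (hf : IsDirichletSeries a f)
    (hmap : Set.MapsTo f rightHalfPlane G) (hm : HasDirichletMeans a f 0.0067) :
    BohrInequality G a 1.7267 := by
  set K := convexHull ℝ G with hKdef
  have hK : IsOpen K := hG.convexHull
  have hGK : G ⊆ K := subset_convexHull ℝ G
  have hKne : K.Nonempty := hne.mono hGK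
  have hfr : (frontier K).Nonempty := by
    rw [Set.nonempty_iff_ne_empty, Ne, frontier_eq_empty_iff]
    rintro (h | h)
    · exact hKne.ne_empty h
    · exact huniv h
  obtain ⟨w, hw, hwd⟩ := isClosed_frontier.exists_infDist_eq_dist hfr (a 1)
  have hwK : w ∉ K := fun h => by
    rw [hK.frontier_eq] at hw
    exact hw.2 h
  obtain ⟨u, hu, hlt⟩ := exists_supporting_halfPlane hK (convex_convexHull ℝ G) hKne hwK
  set d := Metric.infDist (a 1) (frontier K) with hd
  have hline : ∀ t : ℝ, ((0.0067 : ℝ) + t * Complex.I : ℂ) ∈ rightHalfPlane :=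
    ofReal_add_mul_I_mem_rightHalfPlane (by norm_num)
  have hb := (hm.const_sub_mul u (u * w)).isToeplitzPos fun t => by
    rw [Complex.sub_re]
    exact (sub_pos.2 (hlt _ (hGK (hmap (hline t))))).le
  set b : ℕ → ℂ := fun n => ((if n = 1 then u * w else 0) - u * a n) / (n : ℂ) ^ ((0.0067 : ℝ) : ℂ)
    with hbdef
  have hb1 : (b 1).re ≤ d := by
    have : b 1 = u * (w - a 1) := by
      simp only [hbdef, if_true, Nat.cast_one, Complex.one_cpow, div_one, mul_sub]
    rw [this, hwd, dist_comm, dist_eq_norm]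
    refine (Complex.re_le_norm _).trans ?_
    rw [norm_mul, hu, one_mul]
  have hterm : ∀ n : ℕ, 2 ≤ n →
      ‖b n‖ / (n : ℝ) ^ (1.72 : ℝ) = ‖a n‖ / (n : ℝ) ^ (1.7267 : ℝ) := by
    intro n hn
    have hn0 : (0 : ℝ) < n := Nat.cast_pos.2 (by omega)
    have hpow : ‖(n : ℂ) ^ ((0.0067 : ℝ) : ℂ)‖ = (n : ℝ) ^ (0.0067 : ℝ) := by
      rw [Complex.norm_natCast_cpow_of_pos (by omega), Complex.ofReal_re]
    rw [hbdef]
    simp only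
    rw [if_neg (by omega), zero_sub, norm_div, norm_neg, norm_mul, hu, one_mul, hpow, div_div,
      ← Real.rpow_add hn0]
    norm_num
  have hsum : ∀ T : Finset ℕ,
      ∑ n ∈ T, ‖a (n + 2)‖ / ((n + 2 : ℕ) : ℝ) ^ (1.7267 : ℝ) ≤ 99 / 100 * d := by
    intro T
    have h := hb.sum_le (T.map (addRightEmbedding 2)) (by simp)
    rw [Finset.sum_map] at h
    refine le_trans (le_of_eq ?_) (h.trans (by linarith))
    exact Finset.sum_congr rfl fun n _ => (hterm (n + 2) (by omega)).symm
  have hnn : ∀ n : ℕ, 0 ≤ ‖a (n + 2)‖ / ((n + 2 : ℕ) : ℝ) ^ (1.7267 : ℝ) := fun n => by positivity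
  have hsummable := summable_of_sum_le hnn hsum
  refine ⟨hsummable, (hsummable.tsum_le_of_sum_le hsum).trans_lt ?_⟩
  have hd0 : 0 ≤ d := Metric.infDist_nonneg
  -- Strictness needs `d > 0`, and `a 1` is not known in advance to lie in `K`. If `d = 0`, all
  -- later coefficients vanish, so `f 1 = a 1 = w`, a value in `G` outside `K`.
  have hdne : d ≠ 0 := by
    intro h0
    have ha : ∀ n, 2 ≤ n → a n = 0 := by
      intro n hn
      have h := hsum {n - 2}
      rw [Finset.sum_singleton, h0, mul_zero, Nat.sub_add_cancel hn] at h
      have hpos : (0 : ℝ) < (n : ℝ) ^ (1.7267 : ℝ) :=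
        Real.rpow_pos_of_pos (Nat.cast_pos.2 (by omega)) _
      rw [div_le_iff₀ hpos, zero_mul] at h
      exact norm_le_zero_iff.1 h
    have h1 : (1 : ℂ) ∈ rightHalfPlane := by simp [rightHalfPlane]
    have hf1 : f 1 = a 1 := by
      refine tendsto_nhds_unique (hf 1 h1) (tendsto_const_nhds.congr' ?_)
      filter_upwards [eventually_ge_atTop 1] with N hN
      rw [Finset.sum_eq_single_of_mem 1 (Finset.mem_Icc.2 ⟨le_rfl, hN⟩)]
      · simp
      · intro n hn hn1
        have := (Finset.mem_Icc.1 hn).1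
        rw [ha n (by omega), zero_div]
    have haw : a 1 = w := dist_eq_zero.1 (hwd ▸ h0)
    exact hwK (haw ▸ hf1 ▸ hGK (hmap h1))
  have : 0 < d := lt_of_le_of_ne hd0 hdne.symm
  linarith

theorem theorem3p1 :
    (∀ G : Set ℂ, IsOpen G → G.Nonempty → Convex ℝ G → Bornology.IsBounded G →
      bohrAbscissa G ≤ ((1.7267 : ℝ) : EReal)) ∧
    (∀ G : Set ℂ, IsOpen G → IsConnected G → convexHull ℝ G ≠ Set.univ →
      bohrAbscissaAbs G ≤ ((1.7267 : ℝ) : EReal)) := by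
  constructor
  · intro G hG hne hconv hbdd
    refine sInf_le ⟨1.7267, ⟨by norm_num, fun f a hf ha hmap => ?_⟩, rfl⟩
    refine bohrInequality_of_hasDirichletMeans hG hne ?_ ha hmap
      (hf.hasDirichletMeans ha (by norm_num) (by norm_num))
    rw [hconv.convexHull_eq]
    rintro rfl
    exact NormedSpace.unbounded_univ ℝ ℂ hbdd
  · intro G hG hconn huniv
    refine sInf_le ⟨1.7267, ⟨by norm_num, fun f a ha habs hmap => ?_⟩, rfl⟩
    exact bohrInequality_of_hasDirichletMeans hG hconn.nonempty huniv ha hmap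
      (habs.hasDirichletMeans ha (by norm_num))
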